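/- Theorem 1 (Improved Rényi-DP group privacy under the SGM). A dataset is a finite set of examples, and two datasets $\mathcal{D},\mathcal{D}'$ differ in up to $r$ examples if their symmetric difference satisfies $|\mathcal{D}\ominus\mathcal{D}'|\le r$. For probability distributions $P,Q$ and $\alpha>1$ let $\mathrm{D}_\alpha(P\|Q)=\frac{1}{\alpha-1}\ln\int \left(\frac{dP}{dQ}\right)^{\alpha}dQ$ be the Rényi divergence of order $\alpha$ ($+\infty$ if $P\not\ll Q$). Let $q\in[0,1]$, $\sigma>0$, and let $f$ be a function from datasets to $\mathbb{R}^d$. The Sampled Gaussian Mechanism $M$ for $f$ with sampling rate $q$ and noise level $\sigma$ maps a dataset $\mathcal{D}$ to $f(T)+\mathcal{N}(0,\sigma^2\mathbb{I}^d)$, where $T\subseteq\mathcal{D}$ contains each element of $\mathcal{D}$ independently with probability $q$; that is, $$M(\mathcal{D})=\sum_{T\subseteq\mathcal{D}}q^{|T|}(1-q)^{|\mathcal{D}|-|T|}\,\mathcal{N}\left(f(T),\sigma^2\mathbb{I}^d\right).$$ Let $$\mathrm{SG}(\alpha,q,\sigma)=\max\left\{\mathrm{D}_\alpha\left(\mathcal{N}(0,\sigma^2)\,\|\,(1-q)\mathcal{N}(0,\sigma^2)+q\mathcal{N}(1,\sigma^2)\right),\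 \mathrm{D}_\alpha\left((1-q)\mathcal{N}(0,\sigma^2)+q\mathcal{N}(1,\sigma^2)\,\|\,\mathcal{N}(0,\sigma^2)\right)\right\}$$ denote the Rényi-DP parameter of the Sampled Gaussian Mechanism for adjacent datasets. Let $r\in\mathbb{N}$ and assume that $\|f(S)-f(S')\|_2\le 1$ for all datasets $S,S'$ that differ in up to $r$ examples. Then for every $\alpha>1$ and all datasets $\mathcal{D}_1,\mathcal{D}_3$ that differ in up to $r$ examples, $$\mathrm{D}_\alpha\left(M(\mathcal{D}_1)\,\|\,M(\mathcal{D}_3)\right)\le \mathrm{SG}\left(\alpha,\,1-(1-q)^r,\,\sigma\right).$$ In other words, the group privacy bound is obtained from the bound for adjacent datasets by replacing the sampling rate $q$ with $1-(1-q)^r$. -/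

import Mathlib

open MeasureTheory ProbabilityTheory
open scoped ENNReal NNReal

noncomputable section

/-- The Rényi divergence `D_α(P ‖ Q) = (α - 1)⁻¹ log ∫ (dP/dQ)^α dQ` of order `α > 1`,
with values in the extended reals; it is `∞` when `P` is not absolutely continuous with
respect to `Q`. -/
def renyiDiv {Ω : Type*} [MeasurableSpace Ω] (α : ℝ) (P Q : Measure Ω) : EReal :=
  open Classical in
  if P ≪ Q then (((α - 1)⁻¹ : ℝ) : EReal) * ENNReal.log (∫⁻ x, (P.rnDeriv Q x) ^ α ∂Q) else ⊤

/-- The isotropic Gaussian distribution `N(m, σ² I_d)` on `ℝ^d`, the law of `m + σ Z` with `Z`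
a standard Gaussian vector. -/
def isoGaussian {d : ℕ} (m : EuclideanSpace ℝ (Fin d)) (σ : ℝ) :
    Measure (EuclideanSpace ℝ (Fin d)) :=
  (stdGaussian (EuclideanSpace ℝ (Fin d))).map (fun z => m + σ • z)

/-- The output law, on the dataset `S`, of the Sampled Gaussian Mechanism for the function `f`:
a random batch `T ⊆ S` is formed by including every element of `S` independently with
probability `q`, and `f T` is released with additive noise `N(0, σ² I_d)`. Thus the law is the
mixture of the distributions `N(f T, σ² I_d)` with weights `q^|T| (1 - q)^(|S| - |T|)`. -/
def sampledGaussian {X : Type*} {d : ℕ} (f : Finset X → EuclideanSpace ℝ (Fin d)) (q σ : ℝ)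
    (S : Finset X) : Measure (EuclideanSpace ℝ (Fin d)) :=
  ∑ T ∈ S.powerset,
    ENNReal.ofReal (q ^ T.card * (1 - q) ^ (S.card - T.card)) • isoGaussian (f T) σ

/-- The one-dimensional Gaussian distribution `N(m, σ²)`. -/
def realGaussian (m σ : ℝ) : Measure ℝ := gaussianReal m ⟨σ ^ 2, sq_nonneg σ⟩

/-- The two-component Gaussian mixture `(1 - q) N(0, σ²) + q N(1, σ²)` on the real line. -/
def gaussianMixture (q σ : ℝ) : Measure ℝ :=
  ENNReal.ofReal (1 - q) • realGaussian 0 σ + ENNReal.ofReal q • realGaussian 1 σ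

/-- The Rényi-DP budget `SG(α, q, σ)` of the Sampled Gaussian Mechanism for a function of
sensitivity at most one: the larger of the Rényi divergences of order `α` between `N(0, σ²)` and
`(1 - q) N(0, σ²) + q N(1, σ²)`, in the two orders. -/
def sgBudget (α q σ : ℝ) : EReal :=
  max (renyiDiv α (realGaussian 0 σ) (gaussianMixture q σ))
    (renyiDiv α (gaussianMixture q σ) (realGaussian 0 σ))

end

/-!
The Rényi divergence of order `α` is an increasing function of the power divergence `∫ p^α q^(1-α)`,
and by Taylor's formula the latter is a positive combination, over thresholds `k ≥ 1`, of
`k^(α-2) E_k(P ‖ Q) + k^(-α-1) E_k(Q ‖ P)`, where `E_k(P ‖ Q) = (P - k • Q)(univ)` is the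
hockey-stick divergence, the excess mass of `P` over `k • Q` (`lintegral_rnDeriv_rpow_add_eq`). So
it suffices to bound, for every `k`, this weighted sum for the two mechanism outputs by the same
sum for the pair `M = (1-γ) N(0, σ²) + γ N(1, σ²)`, `N(0, σ²)` with `γ = 1 - (1-q)^r`. The two
hockey-stick divergences are bounded together, since their worst cases occur for different pairs of
datasets.

Let `C = D₁ ∩ D₃`, `A = D₁ \ D₃`, `B = D₃ \ D₁`. Hockey-stick divergences are jointly
quasi-convex, so the part `T` of the batch taken from `C` may be fixed. Then both outputs are
Gaussian mixtures containing `N(f T, σ² I)`, with weights `a = (1-q)^|A|` and `b = (1-q)^|B|`, and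
all the means are within distance one of each other. Cancelling the mass `m = min(a, k b)` of the
common component in `P - k Q` and pairing the remaining components gives
`E_k(P ‖ Q) ≤ φ(min(a, k b))`, where `φ(m)` is the excess mass of `(1-m) N(1, σ²)` over
`(k-m) N(0, σ²)`; the Gaussians enter only through the fact that `N(x, σ² I)` and `N(y, σ² I)` with
`‖x - y‖ ≤ 1` are images of `N(1, σ²)` and `N(0, σ²)` under a common Markov kernel
(`exists_isoGaussian_eq_conv`). Likewise `E_k(Q ‖ P) ≤ φ(min(b, k a))`, while for the target pair
the two divergences equal `φ(c)` and `φ(k c)` with `c = (1-q)^r ≤ a b`. What is left,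
`w φ(min(a, k b)) + v φ(min(b, k a)) ≤ w φ(c) + v φ(k c)` for `w ≥ k v`, holds already for the
integrands, as an elementary inequality between positive parts
(`mul_posPart_add_mul_posPart_le`).
-/

/-! ### The excess mass of one measure over another -/

/-- The excess mass of a difference of two densities; applied with `g = k • f'` this is the
hockey-stick divergence written as an integral. -/
lemma withDensity_sub_withDensity_univ {Ω : Type*} [MeasurableSpace Ω] {μ : Measure Ω}
    {f g : Ω → ℝ≥0∞} (hf : Measurable f) (hg : Measurable g) (hgi : ∫⁻ x, g x ∂μ ≠ ∞) :
    (μ.withDensity f - μ.withDensity g) Set.univ = ∫⁻ x, (f x - g x) ∂μ := by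
  have : IsFiniteMeasure (μ.withDensity g) := isFiniteMeasure_withDensity hgi
  rw [← Measure.withDensity_sub hf hg]
  simp

/-- Convolving with a fixed probability measure does not increase the excess mass. -/
lemma sub_conv_univ_le {E : Type*} [AddMonoid E] [MeasurableSpace E] [MeasurableAdd₂ E]
    (μ ν ρ : Measure E) [IsFiniteMeasure μ] [IsFiniteMeasure ν] [IsProbabilityMeasure ρ] :
    (μ ∗ ρ - ν ∗ ρ) Set.univ ≤ (μ - ν) Set.univ := by
  have h : μ ≤ (μ - ν) + ν := Measure.sub_le_iff_le_add.1 le_rfl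
  have h' : μ ∗ ρ ≤ (μ - ν) ∗ ρ + ν ∗ ρ := by
    rw [← Measure.add_conv]
    exact Measure.map_mono (Measure.prod_mono h le_rfl) measurable_add
  refine (Measure.sub_le_of_le_add h' Set.univ).trans_eq ?_
  rw [Measure.conv, Measure.map_apply measurable_add MeasurableSet.univ, Set.preimage_univ,
    ← Set.univ_prod_univ, Measure.prod_prod, measure_univ (μ := ρ), mul_one]

/-- Pushing forward does not increase the excess mass. -/
lemma sub_map_univ_le {E F : Type*} [MeasurableSpace E] [MeasurableSpace F]
    (μ ν : Measure E) [IsFiniteMeasure μ] [IsFiniteMeasure ν] {g : E → F} (hg : Measurable g) :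
    (μ.map g - ν.map g) Set.univ ≤ (μ - ν) Set.univ := by
  have h : μ ≤ (μ - ν) + ν := Measure.sub_le_iff_le_add.1 le_rfl
  have h' : μ.map g ≤ (μ - ν).map g + ν.map g := by
    rw [← Measure.map_add _ _ hg]
    exact Measure.map_mono h hg
  refine (Measure.sub_le_of_le_add h' Set.univ).trans_eq ?_
  rw [Measure.map_apply hg MeasurableSet.univ, Set.preimage_univ]

/-- Joint quasi-convexity of the excess mass. -/
lemma sum_smul_sub_sum_smul_univ_le {Ω ι : Type*} [MeasurableSpace Ω] (I : Finset ι)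
    (w : ι → ℝ≥0∞) (hw : ∑ i ∈ I, w i ≤ 1) (μ ν : ι → Measure Ω)
    [∀ i, IsFiniteMeasure (μ i)] [∀ i, IsFiniteMeasure (ν i)] {c : ℝ≥0∞}
    (h : ∀ i ∈ I, (μ i - ν i) Set.univ ≤ c) :
    (∑ i ∈ I, w i • μ i - ∑ i ∈ I, w i • ν i) Set.univ ≤ c := by
  have h1 : ∑ i ∈ I, w i • μ i ≤ ∑ i ∈ I, w i • (μ i - ν i) + ∑ i ∈ I, w i • ν i := by
    rw [← Finset.sum_add_distrib]
    refine Finset.sum_le_sum fun i _ => ?_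
    rw [← smul_add]
    have := Measure.sub_le_iff_le_add.1 (le_refl (μ i - ν i))
    gcongr
  refine (Measure.sub_le_of_le_add h1 Set.univ).trans ?_
  rw [Measure.finsetSum_apply]
  calc ∑ i ∈ I, (w i • (μ i - ν i)) Set.univ ≤ ∑ i ∈ I, w i * c := by
        refine Finset.sum_le_sum fun i hi => ?_
        rw [Measure.smul_apply, smul_eq_mul]
        exact mul_le_mul_right (h i hi) _
    _ = (∑ i ∈ I, w i) * c := by rw [Finset.sum_mul]
    _ ≤ 1 * c := by gcongr
    _ = c := one_mul c

/-! ### Rényi divergence as an integral of excess masses -/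

lemma lintegral_Ioc_ofReal_eq_sub {a b : ℝ} (hab : a ≤ b) {F F' : ℝ → ℝ}
    (hF : ∀ x ∈ Set.Icc a b, HasDerivAt F (F' x) x) (hc : ContinuousOn F' (Set.Icc a b))
    (h0 : ∀ x ∈ Set.Icc a b, 0 ≤ F' x) :
    ∫⁻ x in Set.Ioc a b, ENNReal.ofReal (F' x) = ENNReal.ofReal (F b - F a) := by
  have hi : IntervalIntegrable F' volume a b := by
    apply ContinuousOn.intervalIntegrable
    rwa [Set.uIcc_of_le hab]
  rw [← intervalIntegral.integral_eq_sub_of_hasDerivAt (by rwa [Set.uIcc_of_le hab]) hi,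
    intervalIntegral.integral_of_le hab]
  rw [ofReal_integral_eq_lintegral_ofReal]
  · exact (intervalIntegrable_iff_integrableOn_Ioc_of_le hab).1 hi
  · exact ae_restrict_of_forall_mem measurableSet_Ioc fun x hx => h0 x ⟨hx.1.le, hx.2⟩

lemma lintegral_Ioi_rpow_mul_pos_part {α τ : ℝ} (hα : 1 < α) (hτ : 1 ≤ τ) :
    ∫⁻ k in Set.Ioi (1 : ℝ), ENNReal.ofReal (k ^ (α - 2) * (τ - k)) =
      ENNReal.ofReal ((τ ^ α - α * τ + (α - 1)) / (α * (α - 1))) := by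
  have hsplit : Set.Ioi (1 : ℝ) = Set.Ioc 1 τ ∪ Set.Ioi τ := by
    rw [Set.Ioc_union_Ioi_eq_Ioi hτ]
  rw [hsplit, lintegral_union measurableSet_Ioi
    (Set.disjoint_left.2 fun x hx hx' => (not_lt.2 hx.2) hx')]
  have hz : ∫⁻ k in Set.Ioi τ, ENNReal.ofReal (k ^ (α - 2) * (τ - k)) = 0 := by
    rw [setLIntegral_congr_fun measurableSet_Ioi (g := fun _ => 0) (fun k hk => ?_)]
    · simp
    · simp only [Set.mem_Ioi] at hk
      exact ENNReal.ofReal_of_nonpos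
        (mul_nonpos_of_nonneg_of_nonpos (Real.rpow_nonneg (by linarith) _) (by linarith))
  rw [hz, add_zero, lintegral_Ioc_ofReal_eq_sub hτ
    (F := fun k => τ * (k ^ (α - 1) / (α - 1)) - k ^ α / α)]
  · congr 1
    have h1 : τ * τ ^ (α - 1) = τ ^ α := by
      rw [mul_comm, Real.rpow_sub_one (by linarith)]; field_simp
    have : α - 1 ≠ 0 := by linarith
    have : α ≠ 0 := by linarith
    simp only [Real.one_rpow]
    rw [← mul_div_assoc, h1]
    field_simp
    ring
  · intro k hk
    have hk0 : k ≠ 0 := by linarith [hk.1]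
    have h1 := ((Real.hasDerivAt_rpow_const (p := α - 1) (Or.inl hk0)).div_const
      (α - 1)).const_mul τ
    have h2 := (Real.hasDerivAt_rpow_const (p := α) (Or.inl hk0)).div_const α
    refine (h1.sub h2).congr_deriv ?_
    have : α - 1 ≠ 0 := by linarith
    have : α ≠ 0 := by linarith
    have e : k ^ (α - 1) = k ^ (α - 2) * k := by
      rw [← Real.rpow_add_one hk0]; ring_nf
    have e2 : α - 1 - 1 = α - 2 := by ring
    rw [e2, e]
    field_simp
  · intro k hk
    have hk0 : k ≠ 0 := by linarith [hk.1]
    exact ((Real.continuousAt_rpow_const _ _ (Or.inl hk0)).mul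
      (by fun_prop)).continuousWithinAt
  · intro k hk
    exact mul_nonneg (Real.rpow_nonneg (by linarith [hk.1]) _) (by linarith [hk.2])

lemma lintegral_Ioi_rpow_mul_neg_part {α τ : ℝ} (hα : 1 < α) (hτ0 : 0 ≤ τ) (hτ : τ ≤ 1) :
    ∫⁻ k in Set.Ioi (1 : ℝ), ENNReal.ofReal (k ^ (-α - 1) * (1 - k * τ)) =
      ENNReal.ofReal ((τ ^ α - α * τ + (α - 1)) / (α * (α - 1))) := by
  have ha1 : α - 1 ≠ 0 := by linarith
  have ha0 : α ≠ 0 := by linarith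
  rcases hτ0.eq_or_lt with rfl | hτ0
  · simp only [mul_zero, sub_zero, mul_one]
    rw [← ofReal_integral_eq_lintegral_ofReal (integrableOn_Ioi_rpow_of_lt (by linarith) one_pos)
      (ae_restrict_of_forall_mem measurableSet_Ioi fun k (hk : 1 < k) =>
        Real.rpow_nonneg (by linarith) _), integral_Ioi_rpow_of_lt (by linarith) one_pos]
    congr 1
    rw [Real.zero_rpow ha0, Real.one_rpow]
    have : -α - 1 + 1 = -α := by ring
    rw [this]
    field_simp
    ring
  have hinv : 1 ≤ τ⁻¹ := (one_le_inv₀ hτ0).2 hτ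
  have hsplit : Set.Ioi (1 : ℝ) = Set.Ioc 1 τ⁻¹ ∪ Set.Ioi τ⁻¹ := by
    rw [Set.Ioc_union_Ioi_eq_Ioi hinv]
  rw [hsplit, lintegral_union measurableSet_Ioi
    (Set.disjoint_left.2 fun x hx hx' => (not_lt.2 hx.2) hx')]
  have hz : ∫⁻ k in Set.Ioi τ⁻¹, ENNReal.ofReal (k ^ (-α - 1) * (1 - k * τ)) = 0 := by
    rw [setLIntegral_congr_fun measurableSet_Ioi (g := fun _ => 0) (fun k hk => ?_)]
    · simp
    · simp only [Set.mem_Ioi] at hk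
      have : 1 < k * τ := by rwa [inv_lt_iff_one_lt_mul₀ hτ0] at hk
      exact ENNReal.ofReal_of_nonpos
        (mul_nonpos_of_nonneg_of_nonpos (Real.rpow_nonneg (by linarith) _) (by linarith))
  rw [hz, add_zero, lintegral_Ioc_ofReal_eq_sub hinv
    (F := fun k => τ * (k ^ (1 - α) / (α - 1)) - k ^ (-α) / α)]
  · congr 1
    have h2 : τ⁻¹ ^ (-α) = τ ^ α := by
      rw [Real.inv_rpow hτ0.le, Real.rpow_neg hτ0.le, inv_inv]
    have h1 : τ * τ⁻¹ ^ (1 - α) = τ ^ α := by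
      rw [Real.inv_rpow hτ0.le, ← Real.rpow_neg hτ0.le]
      have : -(1 - α) = α - 1 := by ring
      rw [this, mul_comm, Real.rpow_sub_one hτ0.ne']; field_simp
    simp only [Real.one_rpow]
    rw [← mul_div_assoc, h1, h2]
    field_simp
    ring
  · intro k hk
    have hk0 : k ≠ 0 := by linarith [hk.1]
    have h1 := ((Real.hasDerivAt_rpow_const (p := 1 - α) (Or.inl hk0)).div_const
      (α - 1)).const_mul τ
    have h2 := (Real.hasDerivAt_rpow_const (p := -α) (Or.inl hk0)).div_const α
    refine (h1.sub h2).congr_deriv ?_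
    have e : k ^ (-α) = k ^ (-α - 1) * k := by
      rw [← Real.rpow_add_one hk0]; ring_nf
    have e2 : 1 - α - 1 = -α := by ring
    rw [e2, e]
    field_simp
    ring
  · intro k hk
    have hk0 : k ≠ 0 := by linarith [hk.1]
    exact ((Real.continuousAt_rpow_const _ _ (Or.inl hk0)).mul
      (by fun_prop)).continuousWithinAt
  · intro k hk
    have : k * τ ≤ 1 := by
      calc k * τ ≤ τ⁻¹ * τ := mul_le_mul_of_nonneg_right hk.2 hτ0.le
        _ = 1 := inv_mul_cancel₀ hτ0.ne'
    exact mul_nonneg (Real.rpow_nonneg (by linarith [hk.1]) _) (by linarith)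

/-- Taylor's formula with integral remainder for `t ↦ t ^ α` at `1`, with the part of the
remainder over `(0, 1)` transported to `(1, ∞)` by `k ↦ k⁻¹`. The term `α - 1` is on the left so
that both sides are sums in `[0, ∞]`. -/
lemma rpow_add_eq_lintegral {α : ℝ} (hα : 1 < α) (t : ℝ≥0∞) :
    t ^ α + ENNReal.ofReal (α - 1) = ENNReal.ofReal α * t + ENNReal.ofReal (α * (α - 1)) *
      ∫⁻ k in Set.Ioi (1 : ℝ), (ENNReal.ofReal (k ^ (α - 2)) * (t - ENNReal.ofReal k) +
        ENNReal.ofReal (k ^ (-α - 1)) * (1 - ENNReal.ofReal k * t)) := by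
  rcases eq_or_ne t ∞ with rfl | ht
  · have : ENNReal.ofReal α ≠ 0 := by simpa using by linarith
    rw [ENNReal.top_rpow_of_pos (by linarith), ENNReal.mul_top this]
    simp
  obtain ⟨τ, hτ0, rfl⟩ : ∃ τ : ℝ, 0 ≤ τ ∧ t = ENNReal.ofReal τ :=
    ⟨t.toReal, ENNReal.toReal_nonneg, (ENNReal.ofReal_toReal ht).symm⟩
  have hint : ∫⁻ k in Set.Ioi (1 : ℝ), (ENNReal.ofReal (k ^ (α - 2)) *
        (ENNReal.ofReal τ - ENNReal.ofReal k) + ENNReal.ofReal (k ^ (-α - 1)) *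
        (1 - ENNReal.ofReal k * ENNReal.ofReal τ)) =
      ENNReal.ofReal ((τ ^ α - α * τ + (α - 1)) / (α * (α - 1))) := by
    have hcongr : ∀ k ∈ Set.Ioi (1 : ℝ), (ENNReal.ofReal (k ^ (α - 2)) *
        (ENNReal.ofReal τ - ENNReal.ofReal k) + ENNReal.ofReal (k ^ (-α - 1)) *
        (1 - ENNReal.ofReal k * ENNReal.ofReal τ)) =
        ENNReal.ofReal (k ^ (α - 2) * (τ - k)) + ENNReal.ofReal (k ^ (-α - 1) * (1 - k * τ)) := by
      intro k (hk : 1 < k)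
      have hk0 : 0 ≤ k := by linarith
      rw [ENNReal.ofReal_mul (Real.rpow_nonneg hk0 _), ENNReal.ofReal_mul (Real.rpow_nonneg hk0 _),
        ENNReal.ofReal_sub _ hk0, ENNReal.ofReal_sub _ (mul_nonneg hk0 hτ0), ENNReal.ofReal_one,
        ENNReal.ofReal_mul hk0]
    rw [setLIntegral_congr_fun measurableSet_Ioi hcongr]
    rcases le_total 1 τ with h | h
    · rw [← lintegral_Ioi_rpow_mul_pos_part hα h]
      refine setLIntegral_congr_fun measurableSet_Ioi fun k (hk : 1 < k) => ?_
      have h2 : k ^ (-α - 1) * (1 - k * τ) ≤ 0 :=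
        mul_nonpos_of_nonneg_of_nonpos (Real.rpow_nonneg (by linarith) _) (by nlinarith)
      simp only [ENNReal.ofReal_of_nonpos h2, add_zero]
    · rw [← lintegral_Ioi_rpow_mul_neg_part hα hτ0 h]
      refine setLIntegral_congr_fun measurableSet_Ioi fun k (hk : 1 < k) => ?_
      have h2 : k ^ (α - 2) * (τ - k) ≤ 0 :=
        mul_nonpos_of_nonneg_of_nonpos (Real.rpow_nonneg (by linarith) _) (by linarith)
      simp only [ENNReal.ofReal_of_nonpos h2, zero_add]
  have hpos : 0 < α * (α - 1) := mul_pos (by linarith) (by linarith)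
  -- Bernoulli's inequality
  have hnn : 0 ≤ τ ^ α - α * τ + (α - 1) := by
    have := one_add_mul_self_le_rpow_one_add (s := τ - 1) (by linarith) hα.le
    rw [add_sub_cancel] at this
    linarith
  rw [hint, ENNReal.ofReal_rpow_of_nonneg hτ0 (by linarith), ← ENNReal.ofReal_mul hpos.le,
    ← ENNReal.ofReal_mul (by linarith), ← ENNReal.ofReal_add (Real.rpow_nonneg hτ0 _) (by linarith),
    ← ENNReal.ofReal_add (mul_nonneg (by linarith) hτ0)
      (mul_nonneg hpos.le (div_nonneg hnn hpos.le)), mul_div_cancel₀ _ hpos.ne']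
  congr 1
  ring

/-- The `α`-th power divergence as a positive combination of the excess masses of the two measures
over each other's multiples (hockey-stick divergences). -/
lemma lintegral_rnDeriv_rpow_add_eq {Ω : Type*} [MeasurableSpace Ω] {α : ℝ} (hα : 1 < α)
    (P Q : Measure Ω) [IsProbabilityMeasure P] [IsProbabilityMeasure Q] (hPQ : P ≪ Q) :
    ∫⁻ x, (P.rnDeriv Q x) ^ α ∂Q + ENNReal.ofReal (α - 1) =
      ENNReal.ofReal α + ENNReal.ofReal (α * (α - 1)) * ∫⁻ k in Set.Ioi (1 : ℝ),
        (ENNReal.ofReal (k ^ (α - 2)) * (P - ENNReal.ofReal k • Q) Set.univ +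
          ENNReal.ofReal (k ^ (-α - 1)) * (Q - ENNReal.ofReal k • P) Set.univ) := by
  set t := P.rnDeriv Q with ht
  have htm : Measurable t := Measure.measurable_rnDeriv P Q
  have hP : Q.withDensity t = P := Measure.withDensity_rnDeriv_eq P Q hPQ
  have htint : ∫⁻ x, t x ∂Q = 1 := by
    rw [← setLIntegral_univ, ← withDensity_apply _ MeasurableSet.univ, hP, measure_univ]
  have h1 : ∀ k : ℝ, (P - ENNReal.ofReal k • Q) Set.univ =
      ∫⁻ x, (t x - ENNReal.ofReal k) ∂Q := by
    intro k
    rw [← withDensity_sub_withDensity_univ htm measurable_const (by simp), hP, withDensity_const]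
  have h2 : ∀ k : ℝ, (Q - ENNReal.ofReal k • P) Set.univ =
      ∫⁻ x, (1 - ENNReal.ofReal k * t x) ∂Q := by
    intro k
    rw [← withDensity_sub_withDensity_univ measurable_const (by fun_prop), withDensity_const,
      one_smul]
    · congr 2
      conv_lhs => rw [← hP]
      exact (withDensity_smul _ htm).symm
    · rw [lintegral_const_mul _ htm, htint]; simp
  have hL : ∫⁻ x, (t x) ^ α ∂Q + ENNReal.ofReal (α - 1) =
      ∫⁻ x, ((t x) ^ α + ENNReal.ofReal (α - 1)) ∂Q := by
    rw [lintegral_add_right _ measurable_const]; simp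
  rw [hL]
  simp_rw [rpow_add_eq_lintegral hα, h1, h2]
  rw [lintegral_add_left (by fun_prop), lintegral_const_mul _ htm, htint, mul_one,
    lintegral_const_mul' _ _ (by simp), lintegral_lintegral_swap (by fun_prop)]
  congr 2
  refine lintegral_congr fun k => ?_
  rw [lintegral_add_left (by fun_prop), lintegral_const_mul _ (by fun_prop),
    lintegral_const_mul _ (by fun_prop)]

/-- Comparison principle: control of the excess masses of `P` and `Q` over each other's multiples
by those of `P'` and `Q'` gives control of the Rényi divergence. The two excess masses are weighed
as in `lintegral_rnDeriv_rpow_add_eq`; the hypothesis asks for the inequality only when the first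
weight is at least `k` times the second. -/
lemma renyiDiv_le_renyiDiv_of_excess_le {Ω Ω' : Type*} [MeasurableSpace Ω] [MeasurableSpace Ω']
    {α : ℝ} (hα : 1 < α) (P Q : Measure Ω) (P' Q' : Measure Ω')
    [IsProbabilityMeasure P] [IsProbabilityMeasure Q]
    [IsProbabilityMeasure P'] [IsProbabilityMeasure Q'] (hPQ : P ≪ Q)
    (h : ∀ k w v : ℝ, 1 ≤ k → 0 ≤ v → k * v ≤ w →
      ENNReal.ofReal w * (P - ENNReal.ofReal k • Q) Set.univ +
        ENNReal.ofReal v * (Q - ENNReal.ofReal k • P) Set.univ ≤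
      ENNReal.ofReal w * (P' - ENNReal.ofReal k • Q') Set.univ +
        ENNReal.ofReal v * (Q' - ENNReal.ofReal k • P') Set.univ) :
    renyiDiv α P Q ≤ renyiDiv α P' Q' := by
  by_cases hPQ' : P' ≪ Q'
  swap
  · rw [renyiDiv, renyiDiv, if_neg hPQ']
    exact le_top
  rw [renyiDiv, renyiDiv, if_pos hPQ, if_pos hPQ']
  refine mul_le_mul_of_nonneg_left (ENNReal.log_monotone ?_)
    (by exact_mod_cast inv_nonneg.2 (by linarith))
  rw [← ENNReal.add_le_add_iff_right (ENNReal.ofReal_ne_top (r := α - 1)),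
    lintegral_rnDeriv_rpow_add_eq hα P Q hPQ, lintegral_rnDeriv_rpow_add_eq hα P' Q' hPQ']
  refine add_le_add le_rfl (mul_le_mul_right ?_ _)
  refine setLIntegral_mono' measurableSet_Ioi fun k (hk : 1 < k) => ?_
  refine h k _ _ hk.le (Real.rpow_nonneg (by linarith) _) ?_
  rw [mul_comm, ← Real.rpow_add_one (by linarith)]
  exact Real.rpow_le_rpow_of_exponent_le hk.le (by linarith)

/-! ### Gaussian distributions -/

instance isProbabilityMeasure_isoGaussian {d : ℕ} (m : EuclideanSpace ℝ (Fin d)) (σ : ℝ) :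
    IsProbabilityMeasure (isoGaussian m σ) :=
  Measure.isProbabilityMeasure_map (by fun_prop)

lemma realGaussian_eq (m σ : ℝ) : realGaussian m σ = gaussianReal m (σ ^ 2).toNNReal := by
  rw [realGaussian, Real.toNNReal_of_nonneg (sq_nonneg σ)]
  rfl

instance isProbabilityMeasure_realGaussian (m σ : ℝ) :
    IsProbabilityMeasure (realGaussian m σ) := by
  rw [realGaussian_eq]; infer_instance

/-- The law of an affine image of a standard Gaussian vector whose linear part `A` has
adjoint `B`. -/
lemma charFun_map_stdGaussian_affine {d : ℕ} (y : EuclideanSpace ℝ (Fin d))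
    {A B : EuclideanSpace ℝ (Fin d) → EuclideanSpace ℝ (Fin d)} (hA : Measurable A)
    (hAB : ∀ z t, inner ℝ (A z) t = inner ℝ z (B t)) (t : EuclideanSpace ℝ (Fin d)) :
    charFun ((stdGaussian (EuclideanSpace ℝ (Fin d))).map (fun z => y + A z)) t =
      Complex.exp (inner ℝ y t * Complex.I - ‖B t‖ ^ 2 / 2) := by
  rw [charFun_apply, integral_map (by fun_prop)
    (Measurable.aestronglyMeasurable (by fun_prop))]
  have h := charFun_stdGaussian (B t)
  rw [charFun_apply] at h
  simp_rw [inner_add_left, hAB, Complex.ofReal_add, add_mul, Complex.exp_add]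
  rw [integral_const_mul, h, ← Complex.exp_add]
  ring_nf

lemma charFun_isoGaussian {d : ℕ} (m : EuclideanSpace ℝ (Fin d)) (σ : ℝ)
    (t : EuclideanSpace ℝ (Fin d)) :
    charFun (isoGaussian m σ) t =
      Complex.exp (inner ℝ m t * Complex.I - ((σ ^ 2 * ‖t‖ ^ 2 : ℝ) : ℂ) / 2) := by
  rw [isoGaussian, charFun_map_stdGaussian_affine m (A := fun z => σ • z) (B := fun z => σ • z)
    (by fun_prop) (fun z t => by rw [real_inner_smul_left, real_inner_smul_right])]
  rw [← Complex.ofReal_pow, norm_smul, mul_pow, Real.norm_eq_abs, sq_abs]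

/-- An isotropic Gaussian splits off a one-dimensional Gaussian component along any direction
`v` of norm at most one; the law `ρ` of the remaining noise does not depend on the mean `m` of that
component. -/
lemma exists_isoGaussian_eq_conv {d : ℕ} (y v : EuclideanSpace ℝ (Fin d)) (hv : ‖v‖ ≤ 1) (σ : ℝ) :
    ∃ ρ : Measure (EuclideanSpace ℝ (Fin d)), IsProbabilityMeasure ρ ∧ ∀ m : ℝ,
      isoGaussian (y + m • v) σ = (realGaussian m σ).map (fun s => s • v) ∗ ρ := by
  -- `A = 1 - c v vᵀ` is a symmetric square root of `1 - v vᵀ`.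
  set w := √(1 - ‖v‖ ^ 2) with hw
  have hw2 : w ^ 2 = 1 - ‖v‖ ^ 2 := Real.sq_sqrt (by nlinarith [norm_nonneg v])
  have hw0 : 0 ≤ w := Real.sqrt_nonneg _
  set c := 1 / (1 + w) with hc
  have hcv : 2 * c - c ^ 2 * ‖v‖ ^ 2 = 1 := by
    rw [show ‖v‖ ^ 2 = 1 - w ^ 2 by linarith, hc]
    field_simp
    ring
  set A : EuclideanSpace ℝ (Fin d) → EuclideanSpace ℝ (Fin d) :=
    fun z => σ • (z - (c * inner ℝ v z) • v) with hA
  have hAm : Measurable A := by fun_prop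
  have hsymm : ∀ z t, inner ℝ (A z) t = inner ℝ z (A t) := by
    intro z t
    simp only [hA, real_inner_smul_left, real_inner_smul_right, inner_sub_left, inner_sub_right]
    rw [real_inner_comm v z]
    ring
  have hnorm : ∀ t, ‖A t‖ ^ 2 = σ ^ 2 * (‖t‖ ^ 2 - inner ℝ v t ^ 2) := by
    intro t
    rw [← real_inner_self_eq_norm_sq (A t)]
    simp only [hA, real_inner_smul_left, real_inner_smul_right, inner_sub_left, inner_sub_right]
    rw [real_inner_comm v t, real_inner_self_eq_norm_sq, real_inner_self_eq_norm_sq]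
    linear_combination (-σ ^ 2 * inner ℝ v t ^ 2) * hcv
  refine ⟨(stdGaussian _).map (fun z => y + A z),
    Measure.isProbabilityMeasure_map (by fun_prop), fun m => ?_⟩
  have hprob : IsProbabilityMeasure ((realGaussian m σ).map (fun s => s • v)) :=
    Measure.isProbabilityMeasure_map (by fun_prop)
  have hprob' : IsProbabilityMeasure
      ((stdGaussian (EuclideanSpace ℝ (Fin d))).map (fun z => y + A z)) :=
    Measure.isProbabilityMeasure_map (by fun_prop)
  refine Measure.ext_of_charFun (funext fun t => ?_)
  have h1 : charFun ((realGaussian m σ).map (fun s => s • v)) t =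
      charFun (realGaussian m σ) (inner ℝ v t) := by
    rw [charFun_apply, charFun_apply_real, integral_map (by fun_prop)
      (Measurable.aestronglyMeasurable (by fun_prop))]
    simp_rw [real_inner_smul_left]
    refine integral_congr_ae (ae_of_all _ fun s => ?_)
    push_cast
    ring_nf
  rw [charFun_isoGaussian, charFun_conv, charFun_map_stdGaussian_affine y hAm hsymm, h1,
    realGaussian_eq, charFun_gaussianReal, ← Complex.exp_add, ← Complex.ofReal_pow ‖A t‖, hnorm]
  congr 1
  rw [inner_add_left, real_inner_smul_left]
  rw [Real.coe_toNNReal _ (sq_nonneg σ)]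
  push_cast
  ring

/-- Gaussians whose means are at distance at most one are images of `N(0, σ²)` and `N(1, σ²)`
under a common Markov kernel. -/
lemma isoGaussian_sub_isoGaussian_univ_le {d : ℕ} {x y : EuclideanSpace ℝ (Fin d)}
    (hxy : ‖x - y‖ ≤ 1) (σ : ℝ) {s t : ℝ≥0∞} (hs : s ≠ ∞)
    (ht : t ≠ ∞) :
    (s • isoGaussian x σ - t • isoGaussian y σ) Set.univ ≤
      (s • realGaussian 1 σ - t • realGaussian 0 σ) Set.univ := by
  obtain ⟨ρ, hρ, h⟩ := exists_isoGaussian_eq_conv y (x - y) hxy σ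
  have hx := h 1
  have hy := h 0
  rw [one_smul, add_sub_cancel] at hx
  rw [zero_smul, add_zero] at hy
  have hm : Measurable fun s : ℝ => s • (x - y) := by fun_prop
  have := Measure.smul_finite (realGaussian 1 σ) hs
  have := Measure.smul_finite (realGaussian 0 σ) ht
  rw [hx, hy, ← Measure.conv_smul_left, ← Measure.conv_smul_left, ← Measure.map_smul,
    ← Measure.map_smul]
  exact (sub_conv_univ_le _ _ ρ).trans (sub_map_univ_le _ _ hm)

lemma realGaussian_absolutelyContinuous (m m' : ℝ) {σ : ℝ} (hσ : 0 < σ) :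
    realGaussian m σ ≪ realGaussian m' σ := by
  have hv : (σ ^ 2).toNNReal ≠ 0 := (Real.toNNReal_pos.2 (by positivity)).ne'
  rw [realGaussian_eq, realGaussian_eq]
  exact (gaussianReal_absolutelyContinuous m hv).trans (gaussianReal_absolutelyContinuous' m' hv)

lemma isoGaussian_absolutelyContinuous {d : ℕ} (x y : EuclideanSpace ℝ (Fin d)) {σ : ℝ}
    (hσ : 0 < σ) : isoGaussian x σ ≪ isoGaussian y σ := by
  obtain ⟨ρ, hρ, h⟩ := exists_isoGaussian_eq_conv y (‖x - y‖⁻¹ • (x - y))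
    (by rw [norm_smul, norm_inv, norm_norm]; exact inv_mul_le_one) σ
  have hx := h ‖x - y‖
  have hy := h 0
  have hxy : ‖x - y‖ • ‖x - y‖⁻¹ • (x - y) = x - y := by
    rcases eq_or_ne (x - y) 0 with h0 | h0
    · simp [h0]
    · exact smul_inv_smul₀ (norm_ne_zero_iff.2 h0) _
  rw [hxy, add_sub_cancel] at hx
  rw [zero_smul, add_zero] at hy
  rw [hx, hy]
  exact (((realGaussian_absolutelyContinuous _ _ hσ).map (by fun_prop)).prod
    Measure.AbsolutelyContinuous.rfl).map measurable_add

/-- The likelihood ratio of `N(1, σ²)` and `N(0, σ²)`. -/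
noncomputable def gaussianRatio (σ x : ℝ) : ℝ := Real.exp ((2 * x - 1) / (2 * σ ^ 2))

lemma gaussianRatio_pos (σ x : ℝ) : 0 < gaussianRatio σ x := Real.exp_pos _

lemma measurable_gaussianRatio (σ : ℝ) : Measurable (gaussianRatio σ) := by
  unfold gaussianRatio; fun_prop

lemma gaussianRatio_mul_reflect (σ x : ℝ) :
    gaussianRatio σ x * gaussianRatio σ (1 - x) = 1 := by
  rw [gaussianRatio, gaussianRatio, ← Real.exp_add, Real.exp_eq_one_iff]
  ring

lemma realGaussian_zero_withDensity {σ : ℝ} (hσ : 0 < σ) :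
    (realGaussian 0 σ).withDensity (fun x => ENNReal.ofReal (gaussianRatio σ x)) =
      realGaussian 1 σ := by
  have hv : (σ ^ 2).toNNReal ≠ 0 := (Real.toNNReal_pos.2 (by positivity)).ne'
  have hm := measurable_gaussianRatio σ
  rw [realGaussian_eq, realGaussian_eq, gaussianReal_of_var_ne_zero _ hv,
    gaussianReal_of_var_ne_zero _ hv,
    ← withDensity_mul _ (by fun_prop) (by fun_prop)]
  congr 1
  ext x
  simp only [Pi.mul_apply, gaussianPDF]
  rw [← ENNReal.ofReal_mul (gaussianPDFReal_nonneg _ _ _)]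
  congr 1
  simp only [gaussianPDFReal, gaussianRatio, Real.coe_toNNReal _ (sq_nonneg σ)]
  rw [mul_assoc, ← Real.exp_add]
  congr 2
  field_simp
  ring

lemma realGaussian_map_reflect (m σ : ℝ) :
    (realGaussian m σ).map (fun x => 1 - x) = realGaussian (1 - m) σ := by
  rw [realGaussian_eq, realGaussian_eq]
  exact gaussianReal_map_const_sub 1

/-! ### Excess masses of two-component Gaussian mixtures -/

/-- The excess mass `∫ ((1 - m) ℓ - (k - m))₊ dN(0, σ²)` of `(1 - m) N(1, σ²)` over
`(k - m) N(0, σ²)`, where `ℓ` is the likelihood ratio. For `m = c` this is the excess mass of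
`c N(0, σ²) + (1 - c) N(1, σ²)` over `k N(0, σ²)`. -/
noncomputable def gaussianExcess (σ k m : ℝ) : ℝ≥0∞ :=
  ∫⁻ x, ENNReal.ofReal ((1 - m) * gaussianRatio σ x - (k - m)) ∂(realGaussian 0 σ)

lemma smul_realGaussian_one_eq_withDensity {σ : ℝ} (hσ : 0 < σ) (s : ℝ≥0∞) :
    s • realGaussian 1 σ =
      (realGaussian 0 σ).withDensity (fun x => s * ENNReal.ofReal (gaussianRatio σ x)) := by
  have hm := measurable_gaussianRatio σ
  rw [← realGaussian_zero_withDensity hσ]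
  exact (withDensity_smul _ (by fun_prop)).symm

lemma smul_realGaussian_sub_univ {σ k m : ℝ} (hσ : 0 < σ) (hm1 : m ≤ 1) (hk : m ≤ k) :
    (ENNReal.ofReal (1 - m) • realGaussian 1 σ - ENNReal.ofReal (k - m) • realGaussian 0 σ)
      Set.univ = gaussianExcess σ k m := by
  have hm := measurable_gaussianRatio σ
  rw [smul_realGaussian_one_eq_withDensity hσ, ← withDensity_const,
    withDensity_sub_withDensity_univ (by fun_prop) measurable_const (by simp), gaussianExcess]
  refine lintegral_congr fun x => ?_
  rw [← ENNReal.ofReal_mul (by linarith), ← ENNReal.ofReal_sub _ (by linarith)]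

lemma gaussianMixture_eq_withDensity {σ c : ℝ} (hσ : 0 < σ) (hc0 : 0 ≤ c) (hc1 : c ≤ 1) :
    gaussianMixture (1 - c) σ = (realGaussian 0 σ).withDensity
      (fun x => ENNReal.ofReal (c + (1 - c) * gaussianRatio σ x)) := by
  have hm := measurable_gaussianRatio σ
  rw [gaussianMixture, smul_realGaussian_one_eq_withDensity hσ, ← withDensity_const,
    ← withDensity_add_left measurable_const]
  congr 1
  ext x
  rw [Pi.add_apply, ← ENNReal.ofReal_mul (by linarith), ← ENNReal.ofReal_add (by linarith)
    (mul_nonneg (by linarith) (gaussianRatio_pos σ x).le), sub_sub_cancel]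

lemma isProbabilityMeasure_gaussianMixture {q : ℝ} (σ : ℝ) (hq0 : 0 ≤ q) (hq1 : q ≤ 1) :
    IsProbabilityMeasure (gaussianMixture q σ) := by
  constructor
  rw [gaussianMixture, Measure.add_apply, Measure.smul_apply, Measure.smul_apply, measure_univ,
    measure_univ, smul_eq_mul, smul_eq_mul, mul_one, mul_one,
    ← ENNReal.ofReal_add (by linarith) hq0, sub_add_cancel, ENNReal.ofReal_one]

lemma gaussianMixture_sub_univ {σ c k : ℝ} (hσ : 0 < σ) (hc0 : 0 ≤ c) (hc1 : c ≤ 1)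
    (hk : 0 ≤ k) :
    (gaussianMixture (1 - c) σ - ENNReal.ofReal k • realGaussian 0 σ) Set.univ =
      gaussianExcess σ k c := by
  have hm := measurable_gaussianRatio σ
  rw [gaussianMixture_eq_withDensity hσ hc0 hc1, ← withDensity_const,
    withDensity_sub_withDensity_univ (by fun_prop) measurable_const (by simp), gaussianExcess]
  refine lintegral_congr fun x => ?_
  rw [← ENNReal.ofReal_sub _ hk]
  congr 1
  ring

/-- In the other order, the reflection `x ↦ 1 - x`, which exchanges the two Gaussians and inverts
their likelihood ratio, brings the excess mass to the same form. -/
lemma sub_gaussianMixture_univ {σ c k : ℝ} (hσ : 0 < σ) (hc0 : 0 ≤ c) (hc1 : c ≤ 1)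
    (hk : 0 ≤ k) :
    (realGaussian 0 σ - ENNReal.ofReal k • gaussianMixture (1 - c) σ) Set.univ =
      gaussianExcess σ k (k * c) := by
  have hm := measurable_gaussianRatio σ
  have hgm := isProbabilityMeasure_gaussianMixture (q := 1 - c) σ (by linarith) (by linarith)
  have hd : ENNReal.ofReal k • gaussianMixture (1 - c) σ = (realGaussian 0 σ).withDensity
      (fun x => ENNReal.ofReal k * ENNReal.ofReal (c + (1 - c) * gaussianRatio σ x)) := by
    rw [gaussianMixture_eq_withDensity hσ hc0 hc1]
    exact (withDensity_smul _ (by fun_prop)).symm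
  have hfin : ∫⁻ x, ENNReal.ofReal k * ENNReal.ofReal (c + (1 - c) * gaussianRatio σ x)
      ∂(realGaussian 0 σ) ≠ ∞ := by
    rw [← setLIntegral_univ, ← withDensity_apply _ MeasurableSet.univ, ← hd, Measure.smul_apply,
      measure_univ, smul_eq_mul, mul_one]
    exact ENNReal.ofReal_ne_top
  have h1 : realGaussian 0 σ = (realGaussian 0 σ).withDensity (fun _ => 1) := by
    rw [withDensity_const, one_smul]
  have h2 : realGaussian 0 σ = (realGaussian 1 σ).map (fun x => 1 - x) := by
    rw [realGaussian_map_reflect, sub_self]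
  have h3 := withDensity_sub_withDensity_univ (measurable_const (a := (1 : ℝ≥0∞)))
    (by fun_prop) hfin
  rw [← hd, ← h1] at h3
  rw [h3]
  conv_lhs => rw [h2]
  rw [lintegral_map (by fun_prop) (by fun_prop), ← realGaussian_zero_withDensity hσ,
    lintegral_withDensity_eq_lintegral_mul _ (by fun_prop) (by fun_prop), gaussianExcess]
  refine lintegral_congr fun x => ?_
  have hpos := gaussianRatio_pos σ x
  have hpos' := gaussianRatio_pos σ (1 - x)
  rw [Pi.mul_apply, ← ENNReal.ofReal_mul hk, ← ENNReal.ofReal_one,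
    ← ENNReal.ofReal_sub _ (mul_nonneg hk (add_nonneg hc0 (mul_nonneg (by linarith) hpos'.le))),
    ← ENNReal.ofReal_mul hpos.le]
  congr 1
  linear_combination (-k * (1 - c)) * gaussianRatio_mul_reflect σ x

/-- The inequality between positive parts behind the group privacy bound. Here `a` and `b` are the
probabilities that no distinguishing element of the respective dataset is sampled, `k` is the
threshold of the hockey-stick divergence, and `ρ` stands for `(ℓ - k) / (ℓ - 1)`. -/
lemma mul_posPart_add_mul_posPart_le {a b c k ρ w v : ℝ} (ha0 : 0 ≤ a) (ha1 : a ≤ 1)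
    (hb0 : 0 ≤ b) (hb1 : b ≤ 1) (hc : c ≤ a * b) (hk : 1 ≤ k) (hρ : ρ ≤ 1) (hv : 0 ≤ v)
    (hw : k * v ≤ w) :
    w * max (ρ - min a (k * b)) 0 + v * max (ρ - min b (k * a)) 0 ≤
      w * max (ρ - c) 0 + v * max (ρ - k * c) 0 := by
  have hvw : v ≤ w := by nlinarith
  have hw0 : 0 ≤ w := hv.trans hvw
  -- By rearrangement, the larger weight may be given to the larger positive part.
  wlog hab : a ≤ b generalizing a b
  · push Not at hab
    refine le_trans ?_ (this hb0 hb1 ha0 ha1 (by linarith [mul_comm a b]) hab.le)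
    have h1 : max (ρ - min a (k * b)) 0 ≤ max (ρ - min b (k * a)) 0 := by
      have : min b (k * a) ≤ min a (k * b) :=
        (min_le_left _ _).trans (le_min hab.le (by nlinarith))
      exact max_le_max (by linarith) le_rfl
    nlinarith
  have hkab : a ≤ k * b := by nlinarith
  have haka : a ≤ k * a := by nlinarith
  have hab1 : a * b ≤ a := by nlinarith
  have hc1 : w * max (ρ - a) 0 ≤ w * max (ρ - c) 0 :=
    mul_le_mul_of_nonneg_left (max_le_max (by linarith) le_rfl) hw0
  have hpos : 0 ≤ v * max (ρ - k * c) 0 := mul_nonneg hv (le_max_right _ _)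
  rw [min_eq_left hkab]
  rcases le_total (k * a) b with h | h
  · rw [min_eq_right h]
    exact add_le_add hc1 (mul_le_mul_of_nonneg_left
      (max_le_max (by nlinarith) le_rfl) hv)
  rw [min_eq_left h]
  rcases le_total ρ b with h2 | h2
  · rw [max_eq_right (a := ρ - b) (by linarith)]
    linarith
  rw [max_eq_left (a := ρ - b) (by linarith), max_eq_left (a := ρ - a) (by linarith),
    max_eq_left (a := ρ - c) (by linarith)]
  have h3 : k * v * (a * (1 - b)) ≤ w * (a * (1 - b)) :=
    mul_le_mul_of_nonneg_right hw (mul_nonneg ha0 (by linarith))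
  have h4 : w * (a * (1 - b)) ≤ w * (a - c) := mul_le_mul_of_nonneg_left (by linarith) hw0
  have h5 : v * (ρ - b) ≤ v * (k * a * (1 - b) + max (ρ - k * c) 0) := by
    refine mul_le_mul_of_nonneg_left ?_ hv
    rcases le_total 1 (k * a) with h6 | h6
    · nlinarith [le_max_right (ρ - k * c) 0]
    · have : k * c ≤ k * (a * b) := mul_le_mul_of_nonneg_left hc (by linarith)
      nlinarith [le_max_left (ρ - k * c) 0]
  linarith

/-- The weighted sum of the two excess masses is largest when all the distinguishing elements
belong to one dataset. -/
lemma gaussianExcess_add_le {σ a b c k w v : ℝ} (ha0 : 0 ≤ a) (ha1 : a ≤ 1)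
    (hb0 : 0 ≤ b) (hb1 : b ≤ 1) (hc : c ≤ a * b) (hk : 1 ≤ k) (hv : 0 ≤ v)
    (hw : k * v ≤ w) :
    ENNReal.ofReal w * gaussianExcess σ k (min a (k * b)) +
        ENNReal.ofReal v * gaussianExcess σ k (min b (k * a)) ≤
      ENNReal.ofReal w * gaussianExcess σ k c + ENNReal.ofReal v * gaussianExcess σ k (k * c) := by
  have hm := measurable_gaussianRatio σ
  have hw0 : 0 ≤ w := by nlinarith
  simp only [gaussianExcess]
  rw [← lintegral_const_mul _ (by fun_prop), ← lintegral_const_mul _ (by fun_prop),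
    ← lintegral_const_mul _ (by fun_prop), ← lintegral_const_mul _ (by fun_prop),
    ← lintegral_add_left (by fun_prop), ← lintegral_add_left (by fun_prop)]
  refine lintegral_mono fun x => ?_
  simp only
  set l := gaussianRatio σ x
  rcases le_or_gt l 1 with hl | hl
  · have hz : ∀ m ≤ 1, ENNReal.ofReal ((1 - m) * l - (k - m)) = 0 := fun m hm1 =>
      ENNReal.ofReal_of_nonpos (by nlinarith)
    rw [hz _ ((min_le_left _ _).trans ha1), hz _ ((min_le_left _ _).trans hb1)]
    simp
  · have hl0 : 0 < l - 1 := by linarith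
    have he : ∀ m, ENNReal.ofReal ((1 - m) * l - (k - m)) =
        ENNReal.ofReal (l - 1) * ENNReal.ofReal (max ((l - k) / (l - 1) - m) 0) := by
      intro m
      have h1 : (1 - m) * l - (k - m) = (l - 1) * ((l - k) / (l - 1) - m) := by
        field_simp
        ring
      rw [h1, ENNReal.ofReal_mul hl0.le]
      congr 1
      rw [ENNReal.ofReal_max, ENNReal.ofReal_zero, max_eq_left zero_le]
    have key := mul_posPart_add_mul_posPart_le ha0 ha1 hb0 hb1 hc hk
      (ρ := (l - k) / (l - 1)) ((div_le_one hl0).2 (by linarith)) hv hw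
    simp only [he, mul_left_comm _ (ENNReal.ofReal (l - 1)), ← mul_add]
    refine mul_le_mul_right ?_ _
    simp only [← ENNReal.ofReal_mul hw0, ← ENNReal.ofReal_mul hv]
    rw [← ENNReal.ofReal_add (by positivity) (by positivity),
      ← ENNReal.ofReal_add (by positivity) (by positivity)]
    exact ENNReal.ofReal_le_ofReal key

/-! ### The sampled Gaussian mechanism -/

lemma sum_ofReal_powerset_weights {X : Type*} {q : ℝ} (hq0 : 0 ≤ q) (hq1 : q ≤ 1)
    (S : Finset X) :
    ∑ T ∈ S.powerset, ENNReal.ofReal (q ^ T.card * (1 - q) ^ (S.card - T.card)) = 1 := by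
  have hq1' : 0 ≤ 1 - q := by linarith
  rw [← ENNReal.ofReal_sum_of_nonneg fun T _ => by positivity, Finset.sum_pow_mul_eq_add_pow,
    add_sub_cancel, one_pow, ENNReal.ofReal_one]

lemma isProbabilityMeasure_sampledGaussian {X : Type*} {d : ℕ}
    (f : Finset X → EuclideanSpace ℝ (Fin d)) {q : ℝ} (σ : ℝ) (hq0 : 0 ≤ q) (hq1 : q ≤ 1)
    (S : Finset X) : IsProbabilityMeasure (sampledGaussian f q σ S) := by
  constructor
  rw [sampledGaussian, Measure.finsetSum_apply]
  simp only [Measure.smul_apply, measure_univ, smul_eq_mul, mul_one]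
  exact sum_ofReal_powerset_weights hq0 hq1 S

lemma sampledGaussian_absolutelyContinuous {X : Type*} {d : ℕ}
    (f : Finset X → EuclideanSpace ℝ (Fin d)) {q σ : ℝ} (hσ : 0 < σ) (hq0 : 0 ≤ q) (hq1 : q ≤ 1)
    (S S' : Finset X) : sampledGaussian f q σ S ≪ sampledGaussian f q σ S' := by
  have h : ∀ x, isoGaussian x σ ≪ sampledGaussian f q σ S' := by
    intro x s hs
    have hw : ∑ T ∈ S'.powerset,
        ENNReal.ofReal (q ^ T.card * (1 - q) ^ (S'.card - T.card)) ≠ 0 := by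
      rw [sum_ofReal_powerset_weights hq0 hq1]; exact one_ne_zero
    obtain ⟨T, hT, hT0⟩ := Finset.exists_ne_zero_of_sum_ne_zero hw
    rw [sampledGaussian, Measure.finsetSum_apply, Finset.sum_eq_zero_iff] at hs
    have := hs T hT
    rw [Measure.smul_apply, smul_eq_mul, mul_eq_zero] at this
    exact isoGaussian_absolutelyContinuous x (f T) hσ (this.resolve_left hT0)
  intro s hs
  rw [sampledGaussian, Measure.finsetSum_apply, Finset.sum_eq_zero_iff]
  intro T _
  rw [Measure.smul_apply, h (f T) hs, smul_zero]

/-- Sampling from a disjoint union amounts to sampling from the two parts independently. -/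
lemma sampledGaussian_union {X : Type*} [DecidableEq X] {d : ℕ}
    (f : Finset X → EuclideanSpace ℝ (Fin d)) {q : ℝ} (σ : ℝ) (hq0 : 0 ≤ q) (hq1 : q ≤ 1)
    {C A : Finset X} (hCA : Disjoint C A) :
    sampledGaussian f q σ (C ∪ A) = ∑ T ∈ C.powerset,
      ENNReal.ofReal (q ^ T.card * (1 - q) ^ (C.card - T.card)) •
        sampledGaussian (fun S => f (T ∪ S)) q σ A := by
  have hq1' : 0 ≤ 1 - q := by linarith
  simp only [sampledGaussian, Finset.smul_sum, smul_smul]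
  rw [← Finset.sum_product']
  refine Finset.sum_nbij' (fun U => (U ∩ C, U ∩ A)) (fun p => p.1 ∪ p.2) ?_ ?_ ?_ ?_ ?_
  · intro U _
    simp
  · rintro ⟨T, S⟩ h
    simp only [Finset.mem_product, Finset.mem_powerset] at h ⊢
    exact Finset.union_subset_union h.1 h.2
  · intro U hU
    rw [Finset.mem_powerset] at hU
    simp only
    rw [← Finset.inter_union_distrib_left, Finset.inter_eq_left.2 hU]
  · rintro ⟨T, S⟩ h
    simp only [Finset.mem_product, Finset.mem_powerset] at h ⊢
    have h1 : T ∩ A = ∅ := Finset.disjoint_iff_inter_eq_empty.1 (hCA.mono_left h.1)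
    have h2 : S ∩ C = ∅ := Finset.disjoint_iff_inter_eq_empty.1 (hCA.symm.mono_left h.2)
    rw [Finset.union_inter_distrib_right, Finset.union_inter_distrib_right, h1, h2,
      Finset.inter_eq_left.2 h.1, Finset.inter_eq_left.2 h.2]
    simp
  · intro U hU
    rw [Finset.mem_powerset] at hU
    have hU' : U ∩ C ∪ U ∩ A = U := by
      rw [← Finset.inter_union_distrib_left, Finset.inter_eq_left.2 hU]
    have hd : Disjoint (U ∩ C) (U ∩ A) :=
      hCA.mono Finset.inter_subset_right Finset.inter_subset_right
    have hcard : U.card = (U ∩ C).card + (U ∩ A).card := by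
      rw [← Finset.card_union_of_disjoint hd, hU']
    have hle1 : (U ∩ C).card ≤ C.card := Finset.card_le_card Finset.inter_subset_right
    have hle2 : (U ∩ A).card ≤ A.card := Finset.card_le_card Finset.inter_subset_right
    simp only
    rw [hU', ← ENNReal.ofReal_mul (by positivity)]
    congr 2
    rw [Finset.card_union_of_disjoint hCA, hcard, mul_mul_mul_comm, ← pow_add, ← pow_add]
    congr 2
    omega

lemma sum_ofReal_div_eq_one {ι : Type*} (I : Finset ι) {u : ι → ℝ} {s : ℝ} (hs : 0 < s)
    (hu : ∀ i ∈ I, 0 ≤ u i) (hsum : ∑ i ∈ I, u i = s) :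
    ∑ i ∈ I, ENNReal.ofReal (u i / s) = 1 := by
  rw [← ENNReal.ofReal_sum_of_nonneg fun i hi => div_nonneg (hu i hi) hs.le, ← Finset.sum_div,
    hsum, div_self hs.ne', ENNReal.ofReal_one]

/-- A combination `∑ u i • μ i` with total weight `s` is the mixture of the measures `s • μ i`
with the weights `u i / s`. -/
lemma sum_ofReal_smul_eq_sum_div_smul {Ω ι : Type*} [MeasurableSpace Ω] (I : Finset ι)
    {u : ι → ℝ} {s : ℝ} (hs : 0 < s) (μ : ι → Measure Ω) :
    ∑ i ∈ I, ENNReal.ofReal (u i) • μ i =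
      ∑ i ∈ I, ENNReal.ofReal (u i / s) • ENNReal.ofReal s • μ i := by
  refine Finset.sum_congr rfl fun i _ => ?_
  rw [smul_smul, ← ENNReal.ofReal_mul' hs.le, div_mul_cancel₀ _ hs.ne']

/-- Every pair of components with means at distance at most one obeys the bound of
`isoGaussian_sub_isoGaussian_univ_le`, hence so does every pair of nonnegative combinations with
the given total weights. -/
lemma sum_isoGaussian_sub_sum_isoGaussian_univ_le {ι κ : Type*} {d : ℕ} {σ : ℝ} (hσ : 0 < σ)
    (I : Finset ι) (J : Finset κ) {p : ι → ℝ} {r : κ → ℝ} (x : ι → EuclideanSpace ℝ (Fin d))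
    (y : κ → EuclideanSpace ℝ (Fin d)) (hp : ∀ i ∈ I, 0 ≤ p i) (hr : ∀ j ∈ J, 0 ≤ r j) {k m : ℝ}
    (hm : m ≤ 1) (hk : 1 ≤ k) (hpm : ∑ i ∈ I, p i = 1 - m) (hrm : ∑ j ∈ J, r j = k - m)
    (hxy : ∀ i ∈ I, ∀ j ∈ J, ‖x i - y j‖ ≤ 1) :
    (∑ i ∈ I, ENNReal.ofReal (p i) • isoGaussian (x i) σ -
      ∑ j ∈ J, ENNReal.ofReal (r j) • isoGaussian (y j) σ) Set.univ ≤ gaussianExcess σ k m := by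
  rcases hm.eq_or_lt with rfl | hm
  · rw [sub_self] at hpm
    have h0 := (Finset.sum_eq_zero_iff_of_nonneg hp).1 hpm
    rw [Finset.sum_congr rfl fun i hi => by rw [h0 i hi, ENNReal.ofReal_zero, zero_smul],
      Finset.sum_const_zero, Measure.zero_sub]
    simp
  have hs : 0 < 1 - m := by linarith
  have ht : 0 < k - m := by linarith
  have hp1 := sum_ofReal_div_eq_one I hs hp hpm
  have hr1 := sum_ofReal_div_eq_one J ht hr hrm
  have hfin : ∀ (c : ℝ) (z : EuclideanSpace ℝ (Fin d)),
      IsFiniteMeasure (ENNReal.ofReal c • isoGaussian z σ) :=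
    fun c z => Measure.smul_finite _ ENNReal.ofReal_ne_top
  rw [sum_ofReal_smul_eq_sum_div_smul I hs]
  set R := ∑ j ∈ J, ENNReal.ofReal (r j) • isoGaussian (y j) σ with hR
  have hRfin : IsFiniteMeasure R := by rw [hR]; infer_instance
  have hR1 : R = ∑ i ∈ I, ENNReal.ofReal (p i / (1 - m)) • R := by
    rw [← Finset.sum_smul, hp1, one_smul]
  rw [hR1]
  refine sum_smul_sub_sum_smul_univ_le I _ hp1.le _ _ fun i hi => ?_
  have hP1 : ENNReal.ofReal (1 - m) • isoGaussian (x i) σ = ∑ j ∈ J,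
      ENNReal.ofReal (r j / (k - m)) • ENNReal.ofReal (1 - m) • isoGaussian (x i) σ := by
    rw [← Finset.sum_smul, hr1, one_smul]
  rw [hR, sum_ofReal_smul_eq_sum_div_smul J ht, hP1]
  refine sum_smul_sub_sum_smul_univ_le J _ hr1.le _ _ fun j hj => ?_
  rw [← smul_realGaussian_sub_univ hσ hm.le (by linarith)]
  exact isoGaussian_sub_isoGaussian_univ_le (hxy i hi j hj) σ ENNReal.ofReal_ne_top
    ENNReal.ofReal_ne_top

lemma sum_ofReal_smul_eq_add {Ω ι : Type*} [MeasurableSpace Ω] [DecidableEq ι] {I : Finset ι}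
    {i₀ : ι} (hi : i₀ ∈ I) {p : ι → ℝ} {m : ℝ} (hm0 : 0 ≤ m) (hm : m ≤ p i₀) (μ : ι → Measure Ω) :
    ∑ i ∈ I, ENNReal.ofReal (p i) • μ i =
      ∑ i ∈ I, ENNReal.ofReal (p i - if i = i₀ then m else 0) • μ i + ENNReal.ofReal m • μ i₀ := by
  rw [← Finset.add_sum_erase I _ hi, ← Finset.add_sum_erase I
    (fun i => ENNReal.ofReal (p i - if i = i₀ then m else 0) • μ i) hi, if_pos rfl, add_right_comm,
    ← add_smul, ← ENNReal.ofReal_add (by linarith) hm0, sub_add_cancel]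
  congr 1
  refine Finset.sum_congr rfl fun i hi' => ?_
  rw [if_neg (Finset.ne_of_mem_erase hi'), sub_zero]

/-- Two Gaussian mixtures with a common component: the part of that component which is present in
both `P` and `k • Q` cancels, so that only the mass `1 - m` of `P` has to be compared with the mass
`k - m` of `k • Q`. -/
lemma sum_isoGaussian_sub_smul_sum_isoGaussian_univ_le {ι κ : Type*} [DecidableEq ι]
    [DecidableEq κ] {d : ℕ} {σ : ℝ} (hσ : 0 < σ) (I : Finset ι) (J : Finset κ) {p : ι → ℝ}
    {r : κ → ℝ} (x : ι → EuclideanSpace ℝ (Fin d)) (y : κ → EuclideanSpace ℝ (Fin d))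
    (hp : ∀ i ∈ I, 0 ≤ p i) (hr : ∀ j ∈ J, 0 ≤ r j) (hp1 : ∑ i ∈ I, p i = 1)
    (hr1 : ∑ j ∈ J, r j = 1) {i₀ : ι} (hi₀ : i₀ ∈ I) {j₀ : κ} (hj₀ : j₀ ∈ J) (h₀ : x i₀ = y j₀)
    {k : ℝ} (hk : 1 ≤ k) (hxy : ∀ i ∈ I, ∀ j ∈ J, ‖x i - y j‖ ≤ 1) :
    (∑ i ∈ I, ENNReal.ofReal (p i) • isoGaussian (x i) σ -
      ENNReal.ofReal k • ∑ j ∈ J, ENNReal.ofReal (r j) • isoGaussian (y j) σ) Set.univ ≤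
      gaussianExcess σ k (min (p i₀) (k * r j₀)) := by
  set m := min (p i₀) (k * r j₀) with hm
  have hk0 : 0 ≤ k := by linarith
  have hmp : m ≤ p i₀ := min_le_left _ _
  have hmr : m ≤ k * r j₀ := min_le_right _ _
  have hm0 : 0 ≤ m := le_min (hp _ hi₀) (mul_nonneg hk0 (hr _ hj₀))
  have hm1 : m ≤ 1 := hmp.trans (hp1 ▸ Finset.single_le_sum hp hi₀)
  have hkr : ENNReal.ofReal k • ∑ j ∈ J, ENNReal.ofReal (r j) • isoGaussian (y j) σ =
      ∑ j ∈ J, ENNReal.ofReal (k * r j) • isoGaussian (y j) σ := by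
    rw [Finset.smul_sum]
    refine Finset.sum_congr rfl fun j _ => ?_
    rw [smul_smul, ENNReal.ofReal_mul hk0]
  rw [hkr, sum_ofReal_smul_eq_add hi₀ hm0 hmp, sum_ofReal_smul_eq_add hj₀ hm0 hmr, h₀]
  have hfin : ∀ (c : ℝ) (z : EuclideanSpace ℝ (Fin d)),
      IsFiniteMeasure (ENNReal.ofReal c • isoGaussian z σ) :=
    fun c z => Measure.smul_finite _ ENNReal.ofReal_ne_top
  refine le_trans (Measure.sub_le_of_le_add (d := _ - _) ?_ Set.univ)
    (sum_isoGaussian_sub_sum_isoGaussian_univ_le hσ I J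
      (p := fun i => p i - if i = i₀ then m else 0)
      (r := fun j => k * r j - if j = j₀ then m else 0) x y ?_ ?_ hm1 hk ?_ ?_ hxy)
  · rw [← add_assoc]
    exact add_le_add_left (Measure.sub_le_iff_le_add.1 le_rfl) _
  · intro i hi
    split_ifs with h
    · rw [h]; linarith
    · simpa using hp i hi
  · intro j hj
    split_ifs with h
    · rw [h]; linarith
    · simpa using mul_nonneg hk0 (hr j hj)
  · rw [Finset.sum_sub_distrib, hp1, Finset.sum_ite_eq' I i₀, if_pos hi₀]
  · rw [Finset.sum_sub_distrib, ← Finset.mul_sum, hr1, mul_one, Finset.sum_ite_eq' J j₀,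
      if_pos hj₀]

/-- The bound for batches from `A` and from `B`: the empty batch, of probability `(1 - q) ^ |A|` and
`(1 - q) ^ |B|` respectively, yields the common component. -/
lemma sampledGaussian_sub_smul_univ_le {X : Type*} [DecidableEq X] {d : ℕ}
    (f : Finset X → EuclideanSpace ℝ (Fin d)) {q σ k : ℝ} (hσ : 0 < σ) (hq0 : 0 ≤ q) (hq1 : q ≤ 1)
    (hk : 1 ≤ k) {A B : Finset X} (hf : ∀ S ⊆ A, ∀ S' ⊆ B, ‖f S - f S'‖ ≤ 1) :
    (sampledGaussian f q σ A - ENNReal.ofReal k • sampledGaussian f q σ B) Set.univ ≤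
      gaussianExcess σ k (min ((1 - q) ^ A.card) (k * (1 - q) ^ B.card)) := by
  have hq1' : 0 ≤ 1 - q := by linarith
  have h := sum_isoGaussian_sub_smul_sum_isoGaussian_univ_le hσ A.powerset B.powerset
    (p := fun T => q ^ T.card * (1 - q) ^ (A.card - T.card))
    (r := fun T => q ^ T.card * (1 - q) ^ (B.card - T.card)) f f
    (fun _ _ => by positivity) (fun _ _ => by positivity)
    (by rw [Finset.sum_pow_mul_eq_add_pow, add_sub_cancel, one_pow])
    (by rw [Finset.sum_pow_mul_eq_add_pow, add_sub_cancel, one_pow])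
    (Finset.empty_mem_powerset A) (Finset.empty_mem_powerset B) rfl hk
    (fun S hS S' hS' => hf S (Finset.mem_powerset.1 hS) S' (Finset.mem_powerset.1 hS'))
  simpa [sampledGaussian] using h

/-- The common elements of two datasets are sampled alike in both, so one may condition on that
part of the batch and mix the bounds. -/
lemma sampledGaussian_union_sub_smul_univ_le {X : Type*} [DecidableEq X] {d : ℕ}
    (f : Finset X → EuclideanSpace ℝ (Fin d)) {q σ k : ℝ} (hσ : 0 < σ) (hq0 : 0 ≤ q) (hq1 : q ≤ 1)
    (hk : 1 ≤ k) {C A B : Finset X} (hCA : Disjoint C A) (hCB : Disjoint C B)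
    (hf : ∀ T ⊆ C, ∀ S ⊆ A, ∀ S' ⊆ B, ‖f (T ∪ S) - f (T ∪ S')‖ ≤ 1) :
    (sampledGaussian f q σ (C ∪ A) - ENNReal.ofReal k • sampledGaussian f q σ (C ∪ B)) Set.univ ≤
      gaussianExcess σ k (min ((1 - q) ^ A.card) (k * (1 - q) ^ B.card)) := by
  rw [sampledGaussian_union f σ hq0 hq1 hCA, sampledGaussian_union f σ hq0 hq1 hCB,
    Finset.smul_sum]
  simp_rw [smul_comm (ENNReal.ofReal k)]
  have hprob : ∀ (g : Finset X → EuclideanSpace ℝ (Fin d)) (S : Finset X),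
      IsProbabilityMeasure (sampledGaussian g q σ S) :=
    fun g S => isProbabilityMeasure_sampledGaussian g σ hq0 hq1 S
  have hfin : ∀ (g : Finset X → EuclideanSpace ℝ (Fin d)) (S : Finset X),
      IsFiniteMeasure (ENNReal.ofReal k • sampledGaussian g q σ S) :=
    fun g S => Measure.smul_finite _ ENNReal.ofReal_ne_top
  refine sum_smul_sub_sum_smul_univ_le _ _ (sum_ofReal_powerset_weights hq0 hq1 C).le _ _
    fun T hT => ?_
  exact sampledGaussian_sub_smul_univ_le _ hσ hq0 hq1 hk (hf T (Finset.mem_powerset.1 hT))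

theorem theorem1 {X : Type*} [DecidableEq X] {d : ℕ} (r : ℕ)
    (f : Finset X → EuclideanSpace ℝ (Fin d))
    (hf : ∀ S S' : Finset X, (symmDiff S S').card ≤ r → ‖f S - f S'‖ ≤ 1)
    (α q σ : ℝ) (hα : 1 < α) (hq0 : 0 ≤ q) (hq1 : q ≤ 1) (hσ : 0 < σ)
    (D₁ D₃ : Finset X) (hD : (symmDiff D₁ D₃).card ≤ r) :
    renyiDiv α (sampledGaussian f q σ D₁) (sampledGaussian f q σ D₃) ≤
      sgBudget α (1 - (1 - q) ^ r) σ := by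
  have hq1' : 0 ≤ 1 - q := by linarith
  have hpow0 : ∀ n : ℕ, 0 ≤ (1 - q) ^ n := fun n => pow_nonneg hq1' n
  have hpow1 : ∀ n : ℕ, (1 - q) ^ n ≤ 1 := fun n => pow_le_one₀ hq1' (by linarith)
  set C := D₁ ∩ D₃ with hC
  set A := D₁ \ D₃ with hA
  set B := D₃ \ D₁ with hB
  have h1 : C ∪ A = D₁ := sup_inf_sdiff D₁ D₃
  have h3 : C ∪ B = D₃ := by rw [hC, Finset.inter_comm]; exact sup_inf_sdiff D₃ D₁
  have hCA : Disjoint C A :=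
    (Finset.disjoint_sdiff (s := D₃) (t := D₁)).mono_left Finset.inter_subset_right
  have hCB : Disjoint C B :=
    (Finset.disjoint_sdiff (s := D₁) (t := D₃)).mono_left Finset.inter_subset_left
  have hAB : symmDiff D₁ D₃ = A ∪ B := rfl
  have hcard : A.card + B.card ≤ r := by
    rwa [← Finset.card_union_of_disjoint disjoint_sdiff_sdiff, ← hAB]
  have hc : (1 - q) ^ r ≤ (1 - q) ^ A.card * (1 - q) ^ B.card := by
    rw [← pow_add]
    exact pow_le_pow_of_le_one hq1' (by linarith) hcard
  -- Batches with the same common part differ only inside `D₁ ∆ D₃`.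
  have hsub : ∀ T S S' : Finset X, S ∪ S' ⊆ A ∪ B → ‖f (T ∪ S) - f (T ∪ S')‖ ≤ 1 := by
    intro T S S' h
    refine hf _ _ ((Finset.card_le_card fun z hz => ?_).trans hD)
    rw [hAB]
    apply h
    simp only [Finset.mem_symmDiff, Finset.mem_union] at hz ⊢
    tauto
  have hM := isProbabilityMeasure_gaussianMixture (q := 1 - (1 - q) ^ r) σ
    (by linarith [hpow1 r]) (by linarith [hpow0 r])
  have hP₁ := isProbabilityMeasure_sampledGaussian f σ hq0 hq1 D₁
  have hP₃ := isProbabilityMeasure_sampledGaussian f σ hq0 hq1 D₃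
  refine le_trans ?_ (le_max_right _ _)
  refine renyiDiv_le_renyiDiv_of_excess_le hα _ _ _ _
    (sampledGaussian_absolutelyContinuous f hσ hq0 hq1 _ _) fun k w v hk hv hw => ?_
  have h13 := sampledGaussian_union_sub_smul_univ_le f hσ hq0 hq1 hk hCA hCB
    fun T _ S hS S' hS' => hsub T S S' (Finset.union_subset_union hS hS')
  have h31 := sampledGaussian_union_sub_smul_univ_le f hσ hq0 hq1 hk hCB hCA
    fun T _ S hS S' hS' => hsub T S S'
      (by rw [Finset.union_comm S S']; exact Finset.union_subset_union hS' hS)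
  rw [h1, h3] at h13 h31
  rw [gaussianMixture_sub_univ hσ (hpow0 r) (hpow1 r) (by linarith),
    sub_gaussianMixture_univ hσ (hpow0 r) (hpow1 r) (by linarith)]
  exact (add_le_add (mul_le_mul_right h13 _) (mul_le_mul_right h31 _)).trans
    (gaussianExcess_add_le (hpow0 _) (hpow1 _) (hpow0 _) (hpow1 _) hc hk hv hw)
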